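/- Let $w>0$ and $Q>1$. A satellite emits $n$ independent symbols $R_1,\dots,R_n$, each uniform on $\{-w,+w\}$. Every symbol is sent to Alice, Bob and Eve through independent, memoryless additive zero-mean Gaussian noise channels with noise variances $Q$ (Alice), $Q$ (Bob) and $1$ (Eve), with outputs $X_i,Y_i,Z_i$. All three parties apply a one-bit quantizer and keep only $X_{q,i}=w\operatorname{sgn}(X_i)$, $Y_{q,i}=w\operatorname{sgn}(Y_i)$, $Z_{q,i}=w\operatorname{sgn}(Z_i)$, respectively. A protocol of blocklength $n\ge 1$ has some number $\ell\ge 1$ of rounds of public communication, with messages $F^{2\ell}=(F_1,\dots,F_{2\ell})$ in countable alphabets of unrestricted size: for $k=1,\dots,\ell$, Alice draws $F_{2k-1}$ according to some $P_{F_{2k-1}|X_q^n,F^{2k-2}}$, and then Bob draws $F_{2k}$ according to some $P_{F_{2k}|Y_q^n,F^{2k-1}}$. Finally, Alice produces a key $K_A$ from $(X_q^n,F^{2\ell})$ and Bob a key $K_B$ from $(Y_q^n,F^{2\ell})$, possibly with local randomness, in a common finite alphabet $\mathcal K$. A rate $R$ is achievable for $(w,Q)$ if for every $\delta>0$ there are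 some $n\ge1$, $\mathcal K$ with $R=\log_2|\mathcal K|/n$, and a protocol with $$\Pr[K_A\ne K_B]\le\delta,\qquad H(K_A)\ge nR-\delta,\qquad I(K_A;F^{2\ell},Z_q^n)\le\delta .$$ Let $S^q(w,Q)$ be the supremum of the achievable rates and, for $\mathcal W\subseteq(0,\infty)$, let $S^q_{\mathcal W}(Q)=\sup_{w\in\mathcal W}S^q(w,Q)$. **Theorem.** For every non-empty bounded set $\mathcal W\subseteq(0,\infty)$, the capacity $S^q_{\mathcal W}(Q)$ is finite for all $Q>1$, and $$S^q_{\mathcal W}(Q)=O\!\left(\frac1{Q^2}\right)\qquad(Q\to\infty),$$ where the implied constant and the threshold for $Q$ may depend on $\mathcal W$. -/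

import Mathlib

open MeasureTheory ProbabilityTheory Filter Asymptotics
open scoped ENNReal NNReal

namespace SatelliteSK

noncomputable section

/-! ### Entropy and mutual information of discrete random variables, in bits -/

/-- Shannon entropy `H(p) = -∑ₐ p(a) log₂ p(a)` of a distribution on a finite alphabet. -/
def entropy {α : Type} [Fintype α] (p : PMF α) : ℝ :=
  ∑ a, -((p a).toReal * Real.logb 2 (p a).toReal)

/-- Mutual information `I(U;V) = ∑_{u,v} p(u,v) log₂ (p(u,v) / (p(u) p(v)))` of a pair `(U, V)` of
discrete random variables with joint law `p`. -/
def mutualInfo {α β : Type} (p : PMF (α × β)) : ℝ :=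
  ∑' c : α × β, (p c).toReal *
    Real.logb 2 ((p c).toReal / ((p.map Prod.fst c.1).toReal * (p.map Prod.snd c.2).toReal))

theorem abs_mul_logb_le {u a b : ℝ} (hu0 : 0 ≤ u) (hua : u ≤ a) (hub : u ≤ b) :
    |u * Real.logb 2 (u / (a * b))| ≤ (a * b + a⁻¹ * b) / Real.log 2 := by
  have hl2 : 0 < Real.log 2 := Real.log_pos (by norm_num)
  rcases hu0.eq_or_lt with h0 | h0
  · rw [← h0]
    simp only [zero_mul, abs_zero]
    have ha : 0 ≤ a := by linarith
    have hb : 0 ≤ b := by linarith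
    positivity
  have ha : 0 < a := by linarith
  have hb : 0 < b := by linarith
  rw [Real.logb, ← mul_div_assoc, abs_div, abs_of_pos hl2]
  refine div_le_div_of_nonneg_right ?_ hl2.le
  have hx : 0 < u / (a * b) := by positivity
  have hup := Real.log_le_sub_one_of_pos hx
  have hlo := Real.log_le_sub_one_of_pos (inv_pos.mpr hx)
  rw [Real.log_inv] at hlo
  have e1 : u * (u / (a * b))⁻¹ = a * b := by field_simp
  have e2 : u * (u / (a * b)) ≤ a⁻¹ * b := by
    have h1 : u * (u / (a * b)) = a⁻¹ * (u * (u / b)) := by field_simp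
    have h2 : u / b ≤ 1 := (div_le_one hb).mpr hub
    rw [h1]
    exact mul_le_mul_of_nonneg_left (by nlinarith) (by positivity)
  have hup' := mul_le_mul_of_nonneg_left hup hu0
  have hlo' := mul_le_mul_of_nonneg_left hlo hu0
  have hab : 0 < a * b := by positivity
  have hab' : 0 < a⁻¹ * b := by positivity
  rw [abs_le]
  constructor <;> linarith

theorem toReal_le_map {γ η : Type} (p : PMF γ) (f : γ → η) (c : γ) :
    (p c).toReal ≤ (p.map f (f c)).toReal := by
  refine ENNReal.toReal_mono (PMF.apply_ne_top _ _) ?_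
  rw [PMF.map_apply]
  exact le_trans (by simp) (ENNReal.le_tsum c)

theorem summable_toReal {γ : Type} (q : PMF γ) : Summable fun c => (q c).toReal :=
  ENNReal.summable_toReal (by rw [q.tsum_coe]; exact ENNReal.one_ne_top)

theorem summable_mul_map {α β : Type} [Fintype α] (f : α → ℝ) (g : β → ℝ) (hg : Summable g) :
    Summable fun c : α × β => f c.1 * g c.2 := by
  have hf : Summable f := Summable.of_finite
  exact summable_mul_of_summable_norm hf.norm hg.norm

/-- When the first variable has a finite alphabet, the series defining the mutual information
converges absolutely, so that `mutualInfo` is the sum of its series. -/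
theorem mutualInfo_summable {α β : Type} [Fintype α] (p : PMF (α × β)) :
    Summable fun c : α × β => (p c).toReal *
      Real.logb 2 ((p c).toReal /
        ((p.map Prod.fst c.1).toReal * (p.map Prod.snd c.2).toReal)) := by
  have h1 := summable_mul_map (fun a => (p.map Prod.fst a).toReal) _
    (summable_toReal (p.map Prod.snd))
  have h2 := summable_mul_map (fun a => (p.map Prod.fst a).toReal⁻¹) _
    (summable_toReal (p.map Prod.snd))
  refine Summable.of_norm_bounded ((h1.add h2).div_const (Real.log 2)) ?_
  intro c
  exact abs_mul_logb_le ENNReal.toReal_nonneg (toReal_le_map p Prod.fst c)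
    (toReal_le_map p Prod.snd c)

/-! ### The satellite source with one-bit quantization -/

/-- BPSK modulation: the satellite sends `+w` or `-w`. -/
def bpsk (w : ℝ) (r : Bool) : ℝ := if r then w else -w

/-- The law of the one-bit quantized output of a Gaussian channel with input `s` and noise
variance `v`. The two quantizer outputs `+w` and `-w` are recorded by their sign, where `true`
stands for `+w`; a zero observation has probability zero. -/
def oneBit (s : ℝ) (v : ℝ≥0) : PMF Bool :=
  haveI : IsProbabilityMeasure ((gaussianReal s v).map fun t : ℝ => decide (0 ≤ t)) :=
    Measure.isProbabilityMeasure_map (Measurable.aemeasurable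
      (measurable_to_bool (by simpa [Set.preimage, Set.Ici] using measurableSet_Ici (a := (0 : ℝ)))))
  ((gaussianReal s v).map fun t : ℝ => decide (0 ≤ t)).toPMF

/-- The joint law of one quantized sample `(X_q, Y_q, Z_q)`: a uniform satellite bit is sent through
independent Gaussian channels with noise variances `Q` (Alice), `Q` (Bob) and `1` (Eve). -/
def sourceLaw (w Q : ℝ) : PMF (Bool × Bool × Bool) :=
  (PMF.uniformOfFintype Bool).bind fun r =>
    (oneBit (bpsk w r) Q.toNNReal).bind fun x =>
      (oneBit (bpsk w r) Q.toNNReal).bind fun y =>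
        (oneBit (bpsk w r) 1).map fun z => (x, y, z)

/-- The law of `n` independent samples of `p`. -/
def iidLaw {α : Type} [Fintype α] (n : ℕ) (p : PMF α) : PMF (Fin n → α) :=
  PMF.ofFintype (fun ω => ∏ i, p (ω i)) (by
    classical
    have h : ∑ a, p a = 1 := by rw [← tsum_fintype (L := .unconditional _), p.tsum_coe]
    rw [← Fintype.piFinset_univ, ← Finset.prod_univ_sum]
    simp [h])

/-! ### Multi-round secret-key agreement -/

/-- A secret-key agreement protocol of blocklength `n` with keys in an alphabet of size `m`.
Messages are elements of the countable alphabet `ℕ`, and a list of messages is a history, its most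
recent message first. Every message and every key may be randomized locally. -/
structure Protocol (n m : ℕ) where
  /-- the number of rounds, in each of which Alice sends a message and then Bob does -/
  rounds : ℕ
  one_le_rounds : 1 ≤ rounds
  /-- the law of Alice's next message, given her sequence and the history -/
  alice : (Fin n → Bool) → List ℕ → PMF ℕ
  /-- the law of Bob's next message, given his sequence and the history -/
  bob : (Fin n → Bool) → List ℕ → PMF ℕ
  /-- the law of Alice's key, given her sequence and all the messages -/
  keyA : (Fin n → Bool) → List ℕ → PMF (Fin m)
  /-- the law of Bob's key, given his sequence and all the messages -/
  keyB : (Fin n → Bool) → List ℕ → PMF (Fin m)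

/-- The law of the first `k` public messages when Alice has observed `x` and Bob `y`; Alice sends
the first message, and the two alternate. -/
def Protocol.transcript {n m : ℕ} (P : Protocol n m) (x y : Fin n → Bool) : ℕ → PMF (List ℕ)
  | 0 => PMF.pure []
  | k + 1 => (P.transcript x y k).bind fun h =>
      (if Even k then P.alice x h else P.bob y h).map fun f => f :: h

/-- The joint law of `(K_A, K_B, F, Z_q^n)`, with `F` the list of all public messages. -/
def Protocol.outcomeLaw {n m : ℕ} (P : Protocol n m) (w Q : ℝ) :
    PMF (Fin m × Fin m × List ℕ × (Fin n → Bool)) :=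
  (iidLaw n (sourceLaw w Q)).bind fun ω =>
    (P.transcript (fun i => (ω i).1) (fun i => (ω i).2.1) (2 * P.rounds)).bind fun t =>
      (P.keyA (fun i => (ω i).1) t).bind fun ka =>
        (P.keyB (fun i => (ω i).2.1) t).map fun kb => (ka, kb, t, fun i => (ω i).2.2)

/-- `R` (in bits per sample) is an achievable secret-key rate for amplitude `w` and channel quality
ratio `Q`: reliability, uniformity and strong secrecy hold up to every `δ > 0`. -/
def Achievable (w Q R : ℝ) : Prop :=
  ∀ δ : ℝ, 0 < δ → ∃ n m : ℕ, 1 ≤ n ∧ R = Real.logb 2 m / n ∧ ∃ P : Protocol n m,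
    (P.outcomeLaw w Q).toOuterMeasure {o | o.1 ≠ o.2.1} ≤ ENNReal.ofReal δ ∧
    n * R - δ ≤ entropy ((P.outcomeLaw w Q).map fun o => o.1) ∧
    mutualInfo ((P.outcomeLaw w Q).map fun o => (o.1, o.2.2)) ≤ δ

/-- The quantized secret-key capacity `S^q(w, Q)`, the supremum of the achievable rates. Achievable
rates are nonnegative; the supremum is taken in `[0, ∞]`. -/
def capacity (w Q : ℝ) : ℝ≥0∞ :=
  ⨆ (R : ℝ) (_ : Achievable w Q R), ENNReal.ofReal R

/-- The quantized secret-key capacity `S^q_W(Q) = sup_{w ∈ W} S^q(w, Q)`. -/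
def capacityOn (W : Set ℝ) (Q : ℝ) : ℝ≥0∞ :=
  ⨆ w ∈ W, capacity w Q

end

end SatelliteSK

/-!
A secret-key rate cannot exceed the conditional mutual information `I(X;Y|Z)` of one sample, and for
the quantized satellite source this is `O(1/Q²)`.

*The converse.* Whatever the protocol, the probability of a transcript `f` factors as
`A(x,f) B(y,f)` (`Protocol.transcript_apply`). Compare the true law with a reference law in which the
source `p(x,y,z)` is replaced by `u(x,z) v(y,z)` and the protocol is kept. Under the latter the two
keys are conditionally independent given `(f, z)`, so Bob cannot guess Alice's key better than by its
conditional law; under the true law he knows it. By two uses of `log t ≤ t - 1`, for each pair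
`(f, z)` separately (`sum_neg_mul_log_le`), the equivocation `H(K_A | F, Z)` is at most the divergence
of `p` from `u v` plus a Fano term. Only finite sums occur in that inequality, and the pairs `(f, z)`
are summed afterwards (`entropy_sub_mutualInfo_le`), so the transcript may have infinite entropy. As
`H(K_A) = I(K_A; F, Z) + H(K_A | F, Z)` (`hasSum_equivocation`) and the divergence of product laws is
additive, `Achievable.mul_log_two_le` follows by letting `δ → 0`.

*The source.* Let `a` and `b` be the biases `P[+|+] - P[-|+]` of the channels with noise variances `Q`
and `1`. Given `Z`, the signs `X` and `Y` have covariance `a² (1 - b²)` and variances `1 - a² b²`, so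
the `χ²`-divergence from conditional independence, which dominates the Kullback-Leibler divergence,
is `(a² (1 - b²) / (1 - a² b²))² ≤ a⁴` (`sum_mul_log_sourceLaw_le`). Finally `a` is the probability
that the noise of variance `Q` lies in `[-w, w]`, so `a² ≤ w² / Q` (`signBias_sq_le`).
-/

namespace SatelliteSK

noncomputable section

/-! ### A logarithmic inequality for nearly independent data -/

/-- For a fixed value of the transcript and of Eve's observation, the contribution of Alice's key to
its equivocation is bounded by a divergence and a reliability term. Here `k` is Alice's key, `x` and
`y` are the remaining data of Alice and of Bob, `p` is their law, `u ⊗ v` is a reference law under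
which Alice and Bob are independent, and `W k y` is a (sub-stochastic) guess of `k` from `y`. The
laws need not be normalized. -/
theorem sum_neg_mul_log_le {K X Y : Type*} [Fintype K] [Fintype X] [Fintype Y]
    (p : K → X → Y → ℝ) (u : K → X → ℝ) (v : Y → ℝ) (W : K → Y → ℝ)
    (hp : ∀ k x y, 0 ≤ p k x y) (hu : ∀ k x, 0 ≤ u k x) (hv : ∀ y, 0 ≤ v y)
    (hac : ∀ k x y, u k x * v y = 0 → p k x y = 0)
    (hW : ∀ k y, 0 < W k y) (hW1 : ∀ y, ∑ k, W k y ≤ 1) :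
    ∑ k, -((∑ x, ∑ y, p k x y) * Real.log ((∑ x, ∑ y, p k x y) / ∑ k, ∑ x, ∑ y, p k x y)) ≤
      (∑ k, ∑ x, ∑ y, p k x y * Real.log (p k x y / (u k x * v y))) +
      (∑ k, ∑ x, ∑ y, p k x y * -Real.log (W k y)) +
      ((∑ k, ∑ x, u k x) * (∑ y, v y) - ∑ k, ∑ x, ∑ y, p k x y) := by
  set T := ∑ k, ∑ x, ∑ y, p k x y with hT
  set V := ∑ y, v y with hV
  have hT0 : 0 ≤ T := Finset.sum_nonneg fun k _ => Finset.sum_nonneg fun x _ =>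
    Finset.sum_nonneg fun y _ => hp k x y
  have hV0 : 0 ≤ V := Finset.sum_nonneg fun y _ => hv y
  have hm0 : ∀ k, 0 ≤ ∑ x, ∑ y, p k x y := fun k => Finset.sum_nonneg fun x _ =>
    Finset.sum_nonneg fun y _ => hp k x y
  have hα0 : ∀ k, 0 ≤ ∑ x, u k x := fun k => Finset.sum_nonneg fun x _ => hu k x
  -- This is `log (s * t) ≤ s + t - 2` with `s` the ratio to `p` of the law in which, instead of
  -- `u k x`, the key `k` is guessed by `W` and `x` follows `u` given `k`, and with `t` the ratio of
  -- the two laws of `k`. Where `p` vanishes, `log 0 = 0` does no harm.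
  have key : ∀ k x y, p k x y * (-Real.log ((∑ x, ∑ y, p k x y) / T)
        - Real.log (p k x y / (u k x * v y)) + Real.log (W k y)) ≤
      u k x / (∑ x, u k x) * (v y / V) * W k y * T
        + p k x y * ((∑ x, u k x) * V / ∑ x, ∑ y, p k x y) - 2 * p k x y := by
    intro k x y
    have hux := hu k x
    have hvy := hv y
    have hWk := hW k y
    have hαk := hα0 k
    have hmk := hm0 k
    rcases (hp k x y).eq_or_lt with h0 | h0
    · rw [← h0]
      simp only [zero_mul, mul_zero, sub_zero, add_zero]
      positivity
    have huv : u k x * v y ≠ 0 := fun h => h0.ne' (hac k x y h)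
    have hux' : 0 < u k x := lt_of_le_of_ne hux fun h => huv (by rw [← h, zero_mul])
    have hvy' : 0 < v y := lt_of_le_of_ne hvy fun h => huv (by rw [← h, mul_zero])
    have hαk' : 0 < ∑ x, u k x := lt_of_lt_of_le hux'
      (Finset.single_le_sum (f := u k) (fun x _ => hu k x) (Finset.mem_univ x))
    have hV' : 0 < V := lt_of_lt_of_le hvy'
      (Finset.single_le_sum (f := v) (fun x _ => hv x) (Finset.mem_univ y))
    have hm1 : p k x y ≤ ∑ x, ∑ y, p k x y :=
      (Finset.single_le_sum (f := p k x) (fun y _ => hp k x y) (Finset.mem_univ y)).trans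
        (Finset.single_le_sum (f := fun x => ∑ y, p k x y)
          (fun x _ => Finset.sum_nonneg fun y _ => hp k x y) (Finset.mem_univ x))
    have hm' : 0 < ∑ x, ∑ y, p k x y := h0.trans_le hm1
    have hT' : 0 < T := hm'.trans_le
      (Finset.single_le_sum (f := fun k => ∑ x, ∑ y, p k x y) (fun k _ => hm0 k)
        (Finset.mem_univ k))
    generalize (∑ x, ∑ y, p k x y) = m at *
    generalize (∑ x, u k x) = α at *
    generalize p k x y = r at *
    have e1 := Real.log_le_sub_one_of_pos
      (show 0 < u k x / α * (v y / V) * W k y * T / r by positivity)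
    have e2 := Real.log_le_sub_one_of_pos (show 0 < α * V / m by positivity)
    have e3 : -Real.log (m / T) - Real.log (r / (u k x * v y)) + Real.log (W k y) =
        Real.log (u k x / α * (v y / V) * W k y * T / r) + Real.log (α * V / m) := by
      simp (disch := positivity) only [Real.log_mul, Real.log_div]
      ring
    rw [e3]
    calc r * _ ≤ r * ((u k x / α * (v y / V) * W k y * T / r - 1) + (α * V / m - 1)) := by gcongr
      _ = _ := by field_simp; ring
  have hsum := Finset.sum_le_sum fun k (_ : k ∈ Finset.univ) =>
    Finset.sum_le_sum fun x (_ : x ∈ Finset.univ) =>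
    Finset.sum_le_sum fun y (_ : y ∈ Finset.univ) => key k x y
  have b1 : ∑ k, ∑ x, ∑ y, u k x / (∑ x, u k x) * (v y / V) * W k y * T ≤ T := by
    have h1 : ∀ k, ∑ x, ∑ y, u k x / (∑ x, u k x) * (v y / V) * W k y * T ≤
        ∑ y, (v y / V) * W k y * T := by
      intro k
      rw [Finset.sum_comm]
      refine Finset.sum_le_sum fun y _ => ?_
      have : ∑ x, u k x / (∑ x, u k x) * (v y / V) * W k y * T =
          (∑ x, u k x) / (∑ x, u k x) * ((v y / V) * W k y * T) := by
        rw [Finset.sum_div, Finset.sum_mul]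
        exact Finset.sum_congr rfl fun x _ => by ring
      rw [this]
      exact mul_le_of_le_one_left (by have := hv y; have := hW k y; positivity) (div_self_le_one _)
    refine (Finset.sum_le_sum fun k _ => h1 k).trans ?_
    rw [Finset.sum_comm]
    calc ∑ y, ∑ k, (v y / V) * W k y * T = ∑ y, (v y / V) * T * ∑ k, W k y := by
          refine Finset.sum_congr rfl fun y _ => ?_
          rw [Finset.mul_sum]
          exact Finset.sum_congr rfl fun k _ => by ring
      _ ≤ ∑ y, (v y / V) * T := Finset.sum_le_sum fun y _ =>
          mul_le_of_le_one_right (by have := hv y; positivity) (hW1 y)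
      _ = V / V * T := by rw [← Finset.sum_mul, ← Finset.sum_div]
      _ ≤ T := mul_le_of_le_one_left hT0 (div_self_le_one _)
  have b2 : ∑ k, ∑ x, ∑ y, p k x y * ((∑ x, u k x) * V / ∑ x, ∑ y, p k x y) ≤
      (∑ k, ∑ x, u k x) * V := by
    rw [Finset.sum_mul]
    refine Finset.sum_le_sum fun k _ => ?_
    simp only [← Finset.sum_mul]
    rw [mul_div_assoc', mul_div_right_comm]
    exact mul_le_of_le_one_left (mul_nonneg (hα0 k) hV0) (div_self_le_one _)
  have e0 : ∑ k, -((∑ x, ∑ y, p k x y) * Real.log ((∑ x, ∑ y, p k x y) / T)) =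
      ∑ k, ∑ x, ∑ y, p k x y * -Real.log ((∑ x, ∑ y, p k x y) / T) := by
    refine Finset.sum_congr rfl fun k _ => ?_
    simp only [← Finset.sum_mul]
    ring
  rw [e0]
  simp only [mul_add, mul_sub, Finset.sum_add_distrib, Finset.sum_sub_distrib, ← Finset.mul_sum]
    at hsum
  rw [← hT] at hsum
  have e4 : (∑ k, ∑ x, ∑ y, p k x y * -Real.log (W k y)) =
      -∑ k, ∑ x, ∑ y, p k x y * Real.log (W k y) := by
    simp only [mul_neg, Finset.sum_neg_distrib]
  simp only [← Finset.sum_mul] at *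
  linarith

/-! ### Marginals and the chain rule for entropy -/

theorem hasSum_toReal_tsum {α : Type} {f : α → ℝ≥0∞} (h : ∑' a, f a ≠ ∞) :
    HasSum (fun a => (f a).toReal) (∑' a, f a).toReal := by
  rw [ENNReal.tsum_toReal_eq fun a => ENNReal.ne_top_of_tsum_ne_top h a]
  exact ENNReal.hasSum_toReal h

theorem hasSum_toReal_pmf {α : Type} (q : PMF α) : HasSum (fun a => (q a).toReal) 1 := by
  have := hasSum_toReal_tsum (f := q) (by rw [q.tsum_coe]; exact ENNReal.one_ne_top)
  rwa [q.tsum_coe, ENNReal.toReal_one] at this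

theorem hasSum_toReal_map_fst {α β : Type} (q : PMF (α × β)) (a : α) :
    HasSum (fun b => (q (a, b)).toReal) (q.map Prod.fst a).toReal := by
  classical
  have h : q.map Prod.fst a = ∑' b, q (a, b) := by
    rw [PMF.map_apply]
    refine (ENNReal.tsum_prod (f := fun a' b => if a = a' then q (a', b) else 0)).trans ?_
    rw [tsum_eq_single a fun a' ha' => by simp [ha'.symm]]
    simp
  rw [h]
  refine hasSum_toReal_tsum ?_
  rw [← h]
  exact PMF.apply_ne_top _ _

theorem toReal_map_snd {α β : Type} [Fintype α] (q : PMF (α × β)) (b : β) :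
    (q.map Prod.snd b).toReal = ∑ a, (q (a, b)).toReal := by
  classical
  rw [PMF.map_apply, ← ENNReal.toReal_sum fun a _ => PMF.apply_ne_top _ _]
  congr 1
  refine (ENNReal.tsum_prod (f := fun a b' => if b = b' then q (a, b') else 0)).trans ?_
  rw [tsum_fintype]
  refine Finset.sum_congr rfl fun a _ => ?_
  rw [tsum_eq_single b fun b' hb' => by simp [hb'.symm]]
  simp

theorem toReal_map_fst_snd_snd {α κ β : Type} [Fintype κ] (J : PMF (α × κ × β)) (a : α) (c : β) :
    (J.map (fun o => (o.1, o.2.2)) (a, c)).toReal = ∑ b, (J (a, b, c)).toReal := by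
  classical
  rw [PMF.map_apply, ← ENNReal.toReal_sum fun a _ => PMF.apply_ne_top _ _]
  congr 1
  refine (ENNReal.tsum_prod
    (f := fun a' bc => @ite _ ((a, c) = (a', bc.2)) (Classical.propDecidable _)
      (J (a', bc)) 0)).trans ?_
  rw [tsum_eq_single a fun a' ha' => by simp [ha'.symm]]
  refine (ENNReal.tsum_prod
    (f := fun b c' => @ite _ ((a, c) = (a, c')) (Classical.propDecidable _)
      (J (a, b, c')) 0)).trans ?_
  rw [tsum_fintype]
  refine Finset.sum_congr rfl fun b _ => ?_
  rw [tsum_eq_single c fun c' hc' => by simp [hc'.symm]]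
  simp

theorem hasSum_fiberwise_snd {α β : Type} [Fintype α] {g : α × β → ℝ} {S : ℝ} (h : HasSum g S) :
    HasSum (fun b => ∑ a, g (a, b)) S :=
  HasSum.prod_fiberwise ((Equiv.prodComm β α).hasSum_iff.mpr h) fun _ => hasSum_fintype _

theorem hasSum_sum_snd {F Z : Type} [Fintype Z] {g : F → Z → ℝ} {S : Z → ℝ}
    (h : ∀ z, HasSum (fun f => g f z) (S z)) :
    HasSum (fun c : F × Z => g c.1 c.2) (∑ z, S z) := by
  classical
  have h1 : ∀ z, HasSum (fun c : F × Z => if c.2 = z then g c.1 z else 0) (S z) := by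
    intro z
    have hinj : Function.Injective fun f : F => (f, z) := fun f f' hf => congrArg Prod.fst hf
    refine (hinj.hasSum_iff ?_).mp ?_
    · rintro ⟨f, z'⟩ hc
      refine if_neg fun hz : z' = z => hc ⟨f, by rw [hz]⟩
    · simpa [Function.comp_def] using h z
  have h2 := hasSum_sum fun z (_ : z ∈ Finset.univ) => h1 z
  simpa using h2

/-- The chain rule `H(U) = I(U;V) + H(U|V)`, with the equivocation `H(U|V)` written as a series over
the values of `V`, so that it does not require `V` to have finite entropy. -/
theorem hasSum_equivocation {α β : Type} [Fintype α] (q : PMF (α × β)) :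
    HasSum (fun b => ∑ a, -((q (a, b)).toReal *
        Real.log ((q (a, b)).toReal / ∑ a, (q (a, b)).toReal)))
      (Real.log 2 * (entropy (q.map Prod.fst) - mutualInfo q)) := by
  have h1 := hasSum_fiberwise_snd (mutualInfo_summable q).hasSum
  have h2 : HasSum (fun b => ∑ a, -((q (a, b)).toReal * Real.logb 2 (q.map Prod.fst a).toReal))
      (entropy (q.map Prod.fst)) :=
    hasSum_sum fun a _ => ((hasSum_toReal_map_fst q a).mul_right _).neg
  have h3 := (h2.sub h1).mul_left (Real.log 2)
  have hl : Real.log 2 ≠ 0 := (Real.log_pos one_lt_two).ne'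
  refine Eq.subst (motive := fun g => HasSum g _) (funext fun b => Eq.symm ?_) h3
  rw [← Finset.sum_sub_distrib, Finset.mul_sum]
  refine Finset.sum_congr rfl fun a _ => ?_
  have ha := toReal_le_map q Prod.fst (a, b)
  have hb := toReal_le_map q Prod.snd (a, b)
  rw [toReal_map_snd] at hb
  simp only [toReal_map_snd]
  rcases (ENNReal.toReal_nonneg (a := q (a, b))).eq_or_lt with h0 | h0
  · simp [← h0]
  have ha' := (h0.trans_le ha).ne'
  have hb' := (h0.trans_le hb).ne'
  simp only at ha' hb'
  rw [Real.logb, Real.logb, Real.log_div h0.ne' hb', Real.log_div h0.ne' (mul_ne_zero ha' hb'),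
    Real.log_mul ha' hb']
  field_simp
  ring

/-! ### The one-shot converse for product-form public discussion -/

/-- The guess of Alice's key `a` from Bob's key `b` behind Fano's inequality: `a = b` up to a uniform
error of probability `ε`. Its logarithmic loss is small when the keys agree. -/
theorem neg_log_kernel_le {K : Type} [Fintype K] [DecidableEq K] {ε : ℝ} (h0 : 0 < ε) (h1 : ε < 1)
    (a b : K) :
    -Real.log (if a = b then 1 - ε else ε / Fintype.card K) ≤
      -Real.log (1 - ε) + (if a = b then 0 else 1) * Real.log (Fintype.card K / ε) := by
  have : Nonempty K := ⟨a⟩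
  split_ifs with h
  · simp
  · rw [← Real.log_inv, inv_div, one_mul]
    have := Real.log_nonpos (by linarith) (show 1 - ε ≤ 1 by linarith)
    linarith

theorem sum_kernel_le {K : Type} [Fintype K] [DecidableEq K] {ε : ℝ} (h0 : 0 < ε) (b : K) :
    ∑ a, (if a = b then 1 - ε else ε / Fintype.card K) ≤ 1 := by
  have : Nonempty K := ⟨b⟩
  calc ∑ a, (if a = b then 1 - ε else ε / Fintype.card K)
      ≤ ∑ a, ((if a = b then 1 - ε else 0) + ε / Fintype.card K) := by
        refine Finset.sum_le_sum fun a _ => ?_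
        split_ifs
        · exact le_add_of_nonneg_right (by positivity)
        · simp
    _ = 1 := by
        rw [Finset.sum_add_distrib]
        simp
        field_simp
        ring

/-- The one-shot secret-key converse. The hypotheses `hAB` and `hJ` say that `J` is the law of
`(K_A, K_B, F, Z)` when `(X, Y, Z)` has the law `p` and, given it, the probability of the transcript
`f` and of the keys `a`, `b` is `A x f a * B y f b`; this product form is what public discussion
with local randomness amounts to. The reference law `u x z * v y z` makes `X` and `Y` conditionally
independent given `Z`. -/
theorem entropy_sub_mutualInfo_le {K X Y Z F : Type} [Fintype K] [DecidableEq K] [Fintype X]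
    [Fintype Y] [Fintype Z]
    (J : PMF (K × K × F × Z)) (p : X → Y → Z → ℝ) (u : X → Z → ℝ) (v : Y → Z → ℝ)
    (A : X → F → K → ℝ) (B : Y → F → K → ℝ)
    (hp : ∀ x y z, 0 < p x y z) (hu : ∀ x z, 0 < u x z) (hv : ∀ y z, 0 < v y z)
    (hA : ∀ x f k, 0 ≤ A x f k) (hB : ∀ y f k, 0 ≤ B y f k)
    (hAB : ∀ x y, HasSum (fun f => (∑ a, A x f a) * ∑ b, B y f b) 1)
    (hJ : ∀ a b f z, (J (a, b, f, z)).toReal = ∑ x, ∑ y, p x y z * A x f a * B y f b)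
    (huv : ∑ z, ∑ x, ∑ y, u x z * v y z = ∑ z, ∑ x, ∑ y, p x y z)
    {ε : ℝ} (h0 : 0 < ε) (h1 : ε < 1) :
    Real.log 2 * (entropy (J.map Prod.fst) - mutualInfo (J.map fun o => (o.1, o.2.2))) ≤
      ∑ z, ∑ x, ∑ y, p x y z * Real.log (p x y z / (u x z * v y z)) - Real.log (1 - ε) +
      (J.toOuterMeasure {o | o.1 ≠ o.2.1}).toReal * Real.log (Fintype.card K / ε) := by
  have hL := hasSum_equivocation (J.map fun o => (o.1, o.2.2))
  rw [PMF.map_comp] at hL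
  -- For each `(x, y)` the transcript probabilities sum to one.
  have hZ : ∀ h : X → Y → Z → ℝ, HasSum (fun c : F × Z =>
      ∑ x, ∑ y, h x y c.2 * ((∑ a, A x c.1 a) * ∑ b, B y c.1 b)) (∑ z, ∑ x, ∑ y, h x y z) := by
    intro h
    refine hasSum_sum_snd (g := fun f z => ∑ x, ∑ y, h x y z * ((∑ a, A x f a) * ∑ b, B y f b))
      fun z => hasSum_sum fun x _ => hasSum_sum fun y _ => ?_
    simpa using (hAB x y).mul_left (h x y z)
  have hD := hZ fun x y z => p x y z * Real.log (p x y z / (u x z * v y z))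
  have hG := hZ fun x y z => u x z * v y z - p x y z
  simp only [Finset.sum_sub_distrib] at hG
  rw [huv, sub_self] at hG
  have hM : HasSum (fun c : F × Z => ∑ a, ∑ b, (J (a, b, c)).toReal) 1 := by
    have h' := hasSum_fiberwise_snd ((Equiv.prodAssoc K K (F × Z)).hasSum_iff.mpr (hasSum_toReal_pmf J))
    simpa [Fintype.sum_prod_type] using h'
  have hE : HasSum (fun c : F × Z => ∑ a, ∑ b, (J (a, b, c)).toReal * (if a = b then 0 else 1))
      (J.toOuterMeasure {o | o.1 ≠ o.2.1}).toReal := by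
    have h : HasSum (fun o : K × K × F × Z => (J o).toReal * (if o.1 = o.2.1 then 0 else 1))
        (J.toOuterMeasure {o | o.1 ≠ o.2.1}).toReal := by
      have hne : ∑' o, Set.indicator {o | o.1 ≠ o.2.1} J o ≠ ∞ := by
        refine ne_top_of_le_ne_top ?_ (ENNReal.tsum_le_tsum (Set.indicator_le_self _ J))
        rw [J.tsum_coe]; exact ENNReal.one_ne_top
      rw [PMF.toOuterMeasure_apply]
      convert hasSum_toReal_tsum hne using 2 with o
      by_cases ho : o.1 = o.2.1 <;> simp [ho]
    have h' := hasSum_fiberwise_snd ((Equiv.prodAssoc K K (F × Z)).hasSum_iff.mpr h)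
    simpa [Fintype.sum_prod_type] using h'
  have hR := ((hD.add (hM.mul_left (-Real.log (1 - ε)))).add
    (hE.mul_right (Real.log (Fintype.card K / ε)))).add hG
  have hfin := hasSum_le (fun c => ?_) hL hR
  · rw [mul_one, add_zero, ← sub_eq_add_neg] at hfin
    exact hfin
  obtain ⟨f, z⟩ := c
  simp only [toReal_map_fst_snd_snd]
  have hK : ∀ k : K, 0 < ε / Fintype.card K := fun k => by
    have : Nonempty K := ⟨k⟩
    positivity
  have key := sum_neg_mul_log_le (fun (k : K) (x : X) (y : Y × K) =>
      p x y.1 z * A x f k * B y.1 f y.2)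
    (fun k x => u x z * A x f k) (fun y => v y.1 z * B y.1 f y.2)
    (fun k y => if k = y.2 then 1 - ε else ε / Fintype.card K)
    (fun k x y => mul_nonneg (mul_nonneg (hp _ _ _).le (hA _ _ _)) (hB _ _ _))
    (fun k x => mul_nonneg (hu _ _).le (hA _ _ _)) (fun y => mul_nonneg (hv _ _).le (hB _ _ _))
    (fun k x y h => by
      have h2 := (hu x z).ne'
      have h3 := (hv y.1 z).ne'
      rcases mul_eq_zero.mp h with h | h
      · rw [(mul_eq_zero.mp h).resolve_left h2]; ring
      · rw [(mul_eq_zero.mp h).resolve_left h3]; ring)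
    (fun k y => by
      split_ifs
      · linarith
      · exact hK k)
    (fun y => sum_kernel_le h0 y.2)
  have eM : ∀ k, ∑ x, ∑ y : Y × K, p x y.1 z * A x f k * B y.1 f y.2 =
      ∑ b, (J (k, b, f, z)).toReal := by
    intro k
    simp only [hJ, Fintype.sum_prod_type]
    rw [Finset.sum_comm (s := (Finset.univ : Finset K))]
    exact Finset.sum_congr rfl fun x _ => Finset.sum_comm
  have eU : (∑ k, ∑ x, u x z * A x f k) * (∑ y : Y × K, v y.1 z * B y.1 f y.2) =
      ∑ x, ∑ y, u x z * v y z * ((∑ a, A x f a) * ∑ b, B y f b) := by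
    rw [Finset.sum_comm, Fintype.sum_prod_type]
    simp only [← Finset.mul_sum]
    rw [Finset.sum_mul_sum]
    exact Finset.sum_congr rfl fun x _ => Finset.sum_congr rfl fun y _ => by ring
  have ePh : ∀ h : X → Y → ℝ, ∑ k, ∑ x, ∑ y : Y × K, p x y.1 z * A x f k * B y.1 f y.2 * h x y.1 =
      ∑ x, ∑ y, p x y z * h x y * ((∑ a, A x f a) * ∑ b, B y f b) := by
    intro h
    rw [Finset.sum_comm]
    refine Finset.sum_congr rfl fun x _ => ?_
    simp only [Fintype.sum_prod_type]
    rw [Finset.sum_comm]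
    refine Finset.sum_congr rfl fun y _ => ?_
    rw [Finset.sum_mul_sum, Finset.mul_sum]
    refine Finset.sum_congr rfl fun a _ => ?_
    rw [Finset.mul_sum]
    exact Finset.sum_congr rfl fun b _ => by ring
  have eP := ePh fun _ _ => 1
  have eD : ∑ k, ∑ x, ∑ y : Y × K, p x y.1 z * A x f k * B y.1 f y.2 *
        Real.log (p x y.1 z * A x f k * B y.1 f y.2 /
          (u x z * A x f k * (v y.1 z * B y.1 f y.2))) =
      ∑ x, ∑ y, p x y z * Real.log (p x y z / (u x z * v y z)) *
        ((∑ a, A x f a) * ∑ b, B y f b) := by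
    rw [← ePh fun x y => Real.log (p x y z / (u x z * v y z))]
    refine Finset.sum_congr rfl fun k _ => Finset.sum_congr rfl fun x _ =>
      Finset.sum_congr rfl fun y _ => ?_
    rcases eq_or_ne (A x f k) 0 with hA0 | hA0
    · simp [hA0]
    rcases eq_or_ne (B y.1 f y.2) 0 with hB0 | hB0
    · simp [hB0]
    congr 2
    have h2 := (hu x z).ne'
    have h3 := (hv y.1 z).ne'
    field_simp
  have eW : ∑ k, ∑ x, ∑ y : Y × K, p x y.1 z * A x f k * B y.1 f y.2 *
        -Real.log (if k = y.2 then 1 - ε else ε / Fintype.card K) =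
      ∑ a, ∑ b, (J (a, b, f, z)).toReal *
        -Real.log (if a = b then 1 - ε else ε / Fintype.card K) := by
    refine Finset.sum_congr rfl fun k _ => ?_
    simp only [hJ, Fintype.sum_prod_type, Finset.sum_mul]
    rw [Finset.sum_comm (s := (Finset.univ : Finset K))]
    exact Finset.sum_congr rfl fun x _ => Finset.sum_comm
  have eW' : ∑ a, ∑ b, (J (a, b, f, z)).toReal *
        -Real.log (if a = b then 1 - ε else ε / Fintype.card K) ≤
      -Real.log (1 - ε) * ∑ a, ∑ b, (J (a, b, f, z)).toReal +
      (∑ a, ∑ b, (J (a, b, f, z)).toReal * (if a = b then 0 else 1)) *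
        Real.log (Fintype.card K / ε) := by
    simp only [Finset.mul_sum, Finset.sum_mul, ← Finset.sum_add_distrib]
    refine Finset.sum_le_sum fun a _ => Finset.sum_le_sum fun b _ => ?_
    refine (mul_le_mul_of_nonneg_left (neg_log_kernel_le h0 h1 a b)
      ENNReal.toReal_nonneg).trans_eq ?_
    ring
  rw [eD, eW, eU] at key
  simp only [mul_one] at eP
  rw [eP] at key
  simp only [eM] at key eP
  rw [← eP] at key
  simp only [sub_mul, Finset.sum_sub_distrib]
  rw [← eP]
  linarith

/-! ### Factorization of the outcome law of a protocol -/

/-- The product of the conditional probabilities of Alice's messages in the history, when she has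
observed `x`. Alice is the sender of a message with an even number of predecessors. -/
def Protocol.aliceLikelihood {n m : ℕ} (P : Protocol n m) (x : Fin n → Bool) : List ℕ → ℝ≥0∞
  | [] => 1
  | f :: h => P.aliceLikelihood x h * if Even h.length then P.alice x h f else 1

/-- The product of the conditional probabilities of Bob's messages in the history, when he has
observed `y`. -/
def Protocol.bobLikelihood {n m : ℕ} (P : Protocol n m) (y : Fin n → Bool) : List ℕ → ℝ≥0∞
  | [] => 1
  | f :: h => P.bobLikelihood y h * if Even h.length then 1 else P.bob y h f

/-- The probability of a transcript is a function of `(x, h)` times a function of `(y, h)`. Thus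
public discussion creates no dependence between Alice and Bob beyond what its transcript reveals. -/
theorem Protocol.transcript_apply {n m : ℕ} (P : Protocol n m) (x y : Fin n → Bool) (k : ℕ)
    (h : List ℕ) : P.transcript x y k h =
      P.aliceLikelihood x h * if h.length = k then P.bobLikelihood y h else 0 := by
  classical
  induction k generalizing h with
  | zero =>
    cases h <;> simp [Protocol.transcript, Protocol.aliceLikelihood, Protocol.bobLikelihood]
  | succ k ih =>
    cases h with
    | nil => simp [Protocol.transcript, PMF.bind_apply, PMF.map_apply]
    | cons f h =>
      have hmap : ∀ (q : PMF ℕ) (h' : List ℕ),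
          (q.map fun f => f :: h') (f :: h) = if h' = h then q f else 0 := by
        intro q h'
        rw [PMF.map_apply, tsum_eq_single f fun f' hf' => by simp [hf'.symm]]
        simp [eq_comm]
      simp only [Protocol.transcript, PMF.bind_apply, hmap]
      rw [tsum_eq_single h fun h' hh' => by simp [hh']]
      rw [ih]
      simp only [Protocol.aliceLikelihood, Protocol.bobLikelihood, List.length_cons,
        Nat.add_right_cancel_iff, if_true]
      by_cases hl : h.length = k
      · subst hl
        by_cases he : Even h.length <;> simp [he] <;> ring
      · simp [hl]

theorem sum_pi_triple {ι A B C : Type} [Fintype ι] [DecidableEq ι] [Fintype A] [Fintype B]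
    [Fintype C] {M : Type*} [AddCommMonoid M] (g : (ι → A × B × C) → M) :
    ∑ ω, g ω = ∑ z : ι → C, ∑ x : ι → A, ∑ y : ι → B, g fun i => (x i, y i, z i) := by
  let e : (ι → C) × (ι → A) × (ι → B) ≃ (ι → A × B × C) :=
    { toFun := fun c i => (c.2.1 i, c.2.2 i, c.1 i)
      invFun := fun ω => (fun i => (ω i).2.2, fun i => (ω i).1, fun i => (ω i).2.1)
      left_inv := fun _ => rfl
      right_inv := fun _ => rfl }
  rw [← e.sum_comp]
  simp only [Fintype.sum_prod_type]
  rfl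

theorem Protocol.outcomeLaw_apply {n m : ℕ} (P : Protocol n m) (w Q : ℝ) (a b : Fin m)
    (f : List ℕ) (z : Fin n → Bool) :
    P.outcomeLaw w Q (a, b, f, z) = ∑ x, ∑ y, iidLaw n (sourceLaw w Q) (fun i => (x i, y i, z i)) *
      (P.transcript x y (2 * P.rounds) f * (P.keyA x f a * P.keyB y f b)) := by
  classical
  have hin : ∀ ω : Fin n → Bool × Bool × Bool,
      ((P.transcript (fun i => (ω i).1) (fun i => (ω i).2.1) (2 * P.rounds)).bind fun t =>
        (P.keyA (fun i => (ω i).1) t).bind fun ka => (P.keyB (fun i => (ω i).2.1) t).map fun kb =>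
          (ka, kb, t, fun i => (ω i).2.2)) (a, b, f, z) =
      if z = (fun i => (ω i).2.2) then
        P.transcript (fun i => (ω i).1) (fun i => (ω i).2.1) (2 * P.rounds) f *
          (P.keyA (fun i => (ω i).1) f a * P.keyB (fun i => (ω i).2.1) f b) else 0 := by
    intro ω
    simp only [PMF.bind_apply, PMF.map_apply]
    rw [tsum_eq_single f fun f' hf' => by simp [hf'.symm],
      tsum_eq_single a fun a' ha' => by simp [ha'.symm],
      tsum_eq_single b fun b' hb' => by simp [hb'.symm]]
    simp only [Prod.mk.injEq, true_and]
    split_ifs <;> simp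
  rw [Protocol.outcomeLaw, PMF.bind_apply]
  simp only [hin]
  rw [tsum_fintype, sum_pi_triple, Finset.sum_eq_single z]
  · simp
  · intro z' _ hz'
    simp [hz'.symm]
  · simp

theorem Protocol.toReal_outcomeLaw {n m : ℕ} (P : Protocol n m) (w Q : ℝ) (a b : Fin m)
    (f : List ℕ) (z : Fin n → Bool) :
    (P.outcomeLaw w Q (a, b, f, z)).toReal =
      ∑ x, ∑ y, (∏ i, (sourceLaw w Q (x i, y i, z i)).toReal) *
        (P.aliceLikelihood x f * P.keyA x f a).toReal *
        ((if f.length = 2 * P.rounds then P.bobLikelihood y f else 0) * P.keyB y f b).toReal := by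
  have hne : ∀ x y, iidLaw n (sourceLaw w Q) (fun i => (x i, y i, z i)) *
      (P.transcript x y (2 * P.rounds) f * (P.keyA x f a * P.keyB y f b)) ≠ ∞ := fun x y =>
    ENNReal.mul_ne_top (PMF.apply_ne_top _ _) (ENNReal.mul_ne_top (PMF.apply_ne_top _ _)
      (ENNReal.mul_ne_top (PMF.apply_ne_top _ _) (PMF.apply_ne_top _ _)))
  rw [P.outcomeLaw_apply, ENNReal.toReal_sum fun x _ =>
    ENNReal.sum_ne_top.mpr fun y _ => hne x y]
  refine Finset.sum_congr rfl fun x _ => ?_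
  rw [ENNReal.toReal_sum fun y _ => hne x y]
  refine Finset.sum_congr rfl fun y _ => ?_
  simp only [P.transcript_apply, ENNReal.toReal_mul, iidLaw, PMF.ofFintype_apply,
    ENNReal.toReal_prod]
  ring

/-! ### Single-letterization -/

theorem sum_pi_prod {ι α : Type} [Fintype ι] [DecidableEq ι] [Fintype α] (g : ι → α → ℝ) :
    ∑ ω : ι → α, ∏ i, g i (ω i) = ∏ i, ∑ a, g i a := by
  rw [Finset.prod_univ_sum, Fintype.piFinset_univ]

/-- The expectation of a sum of functions of the letters of an i.i.d. word. -/
theorem sum_prod_mul_sum {α : Type} [Fintype α] (n : ℕ) (p d : α → ℝ) (hp : ∑ a, p a = 1) :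
    ∑ ω : Fin n → α, (∏ i, p (ω i)) * ∑ i, d (ω i) = n * ∑ a, p a * d a := by
  have h : ∀ i : Fin n, ∑ ω : Fin n → α, (∏ j, p (ω j)) * d (ω i) = ∑ a, p a * d a := by
    intro i
    have h1 : ∀ ω : Fin n → α, (∏ j, p (ω j)) * d (ω i) =
        ∏ j, p (ω j) * (if j = i then d (ω j) else 1) := by
      intro ω
      rw [Finset.prod_mul_distrib]
      simp
    simp only [h1]
    rw [sum_pi_prod fun j a => p a * if j = i then d a else 1, Finset.prod_eq_single i]
    · simp
    · intro j _ hj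
      simp [hj, hp]
    · simp
  simp only [Finset.mul_sum]
  rw [Finset.sum_comm]
  simp [h, Finset.mul_sum]

theorem sum_toReal_pmf {α : Type} [Fintype α] (q : PMF α) : ∑ a, (q a).toReal = 1 :=
  (hasSum_fintype _).unique (hasSum_toReal_pmf q)

/-- The converse for `n` samples, in single-letter form. -/
theorem Protocol.entropy_sub_mutualInfo_le {n m : ℕ} (P : Protocol n m) (w Q : ℝ)
    (u v : Bool → Bool → ℝ) (hp : ∀ c, 0 < (sourceLaw w Q c).toReal)
    (hu : ∀ x z, 0 < u x z) (hv : ∀ y z, 0 < v y z)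
    (huv : ∑ c : Bool × Bool × Bool, u c.1 c.2.2 * v c.2.1 c.2.2 = 1)
    {ε : ℝ} (h0 : 0 < ε) (h1 : ε < 1) :
    Real.log 2 * (entropy ((P.outcomeLaw w Q).map fun o => o.1) -
        mutualInfo ((P.outcomeLaw w Q).map fun o => (o.1, o.2.2))) ≤
      n * (∑ c : Bool × Bool × Bool, (sourceLaw w Q c).toReal *
        Real.log ((sourceLaw w Q c).toReal / (u c.1 c.2.2 * v c.2.1 c.2.2))) - Real.log (1 - ε) +
      ((P.outcomeLaw w Q).toOuterMeasure {o | o.1 ≠ o.2.1}).toReal * Real.log (m / ε) := by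
  have key := SatelliteSK.entropy_sub_mutualInfo_le (P.outcomeLaw w Q)
    (fun x y z => ∏ i, (sourceLaw w Q (x i, y i, z i)).toReal)
    (fun x z => ∏ i, u (x i) (z i)) (fun y z => ∏ i, v (y i) (z i))
    (fun x f a => (P.aliceLikelihood x f * P.keyA x f a).toReal)
    (fun y f b => ((if f.length = 2 * P.rounds then P.bobLikelihood y f else 0) *
      P.keyB y f b).toReal)
    (fun x y z => Finset.prod_pos fun i _ => hp _) (fun x z => Finset.prod_pos fun i _ => hu _ _)
    (fun y z => Finset.prod_pos fun i _ => hv _ _)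
    (fun _ _ _ => ENNReal.toReal_nonneg) (fun _ _ _ => ENNReal.toReal_nonneg)
    (fun x y => by
      have h := hasSum_toReal_pmf (P.transcript x y (2 * P.rounds))
      simp only [P.transcript_apply, ENNReal.toReal_mul] at h
      simpa only [ENNReal.toReal_mul, ← Finset.mul_sum, sum_toReal_pmf, mul_one] using h)
    (P.toReal_outcomeLaw w Q)
    (by
      have e1 := sum_pi_triple (ι := Fin n) (A := Bool) (B := Bool) (C := Bool)
        fun ω => ∏ i, u (ω i).1 (ω i).2.2 * v (ω i).2.1 (ω i).2.2
      have e2 := sum_pi_triple (ι := Fin n) (A := Bool) (B := Bool) (C := Bool)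
        fun ω => ∏ i, (sourceLaw w Q (ω i)).toReal
      simp only [Finset.prod_mul_distrib] at e1
      rw [← e1, ← e2, sum_pi_prod fun _ c => (sourceLaw w Q c).toReal]
      simp only [← Finset.prod_mul_distrib]
      rw [sum_pi_prod fun _ (c : Bool × Bool × Bool) => u c.1 c.2.2 * v c.2.1 c.2.2, huv,
        sum_toReal_pmf])
    h0 h1
  rw [Fintype.card_fin] at key
  refine key.trans_eq ?_
  congr 2
  have e := sum_prod_mul_sum n (fun c => (sourceLaw w Q c).toReal) (fun c =>
    Real.log ((sourceLaw w Q c).toReal / (u c.1 c.2.2 * v c.2.1 c.2.2))) (sum_toReal_pmf _)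
  rw [← e, sum_pi_triple]
  refine Finset.sum_congr rfl fun z _ => Finset.sum_congr rfl fun x _ =>
    Finset.sum_congr rfl fun y _ => ?_
  rw [← Finset.prod_mul_distrib, ← Finset.prod_div_distrib, Real.log_prod fun i _ => ?_]
  exact (div_pos (hp _) (mul_pos (hu _ _) (hv _ _))).ne'

/-- An achievable rate is at most the divergence of the source from any law `u x z * v y z` with
conditionally independent `X` and `Y`. The least such divergence is `I(X;Y|Z)`. -/
theorem Achievable.mul_log_two_le {w Q R : ℝ} (hR : Achievable w Q R)
    (u v : Bool → Bool → ℝ) (hp : ∀ c, 0 < (sourceLaw w Q c).toReal)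
    (hu : ∀ x z, 0 < u x z) (hv : ∀ y z, 0 < v y z)
    (huv : ∑ c : Bool × Bool × Bool, u c.1 c.2.2 * v c.2.1 c.2.2 = 1) :
    R * Real.log 2 ≤ ∑ c : Bool × Bool × Bool, (sourceLaw w Q c).toReal *
        Real.log ((sourceLaw w Q c).toReal / (u c.1 c.2.2 * v c.2.1 c.2.2)) := by
  set D := ∑ c : Bool × Bool × Bool, (sourceLaw w Q c).toReal *
        Real.log ((sourceLaw w Q c).toReal / (u c.1 c.2.2 * v c.2.1 c.2.2)) with hD
  have hl2 : 0 < Real.log 2 := Real.log_pos one_lt_two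
  -- The tolerance `δ` also serves as the error parameter of the guess in Fano's inequality.
  have hδ : ∀ δ : ℝ, 0 < δ → δ < 1 → R * Real.log 2 * (1 - δ) ≤
      D + (2 * δ * Real.log 2 - Real.log (1 - δ) - δ * Real.log δ) := by
    intro δ h0 h1
    obtain ⟨n, m, hn, hRm, P, herr, hent, hsec⟩ := hR δ h0
    have key := P.entropy_sub_mutualInfo_le w Q u v hp hu hv huv h0 h1
    rw [← hD] at key
    have hn' : (1 : ℝ) ≤ n := by exact_mod_cast hn
    obtain ⟨k, -⟩ := (P.keyA (fun _ => true) []).support_nonempty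
    have hm : (1 : ℝ) ≤ m := by exact_mod_cast k.pos
    have hlog : Real.log m = n * (R * Real.log 2) := by
      rw [hRm, Real.logb]
      field_simp
    have hlogd : Real.log δ ≤ 0 := Real.log_nonpos h0.le h1.le
    have hlogm : 0 ≤ Real.log m := Real.log_nonneg hm
    rw [Real.log_div (by linarith) h0.ne'] at key
    have herr' : ((P.outcomeLaw w Q).toOuterMeasure {o | o.1 ≠ o.2.1}).toReal ≤ δ :=
      ENNReal.toReal_le_of_le_ofReal h0.le herr
    have k1 := mul_le_mul_of_nonneg_right herr' (show 0 ≤ Real.log m - Real.log δ by linarith)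
    have k2 := mul_le_mul_of_nonneg_left (show n * R - 2 * δ ≤
      entropy ((P.outcomeLaw w Q).map fun o => o.1) -
        mutualInfo ((P.outcomeLaw w Q).map fun o => (o.1, o.2.2)) by linarith) hl2.le
    rw [hlog] at k1
    have hE : 0 ≤ 2 * δ * Real.log 2 - Real.log (1 - δ) - δ * Real.log δ := by
      have e1 := Real.log_nonpos (show 0 ≤ 1 - δ by linarith) (by linarith)
      have e2 := mul_nonpos_of_nonneg_of_nonpos h0.le hlogd
      have e3 : 0 ≤ 2 * δ * Real.log 2 := by positivity
      linarith
    have k3 : (n : ℝ) * (R * Real.log 2 * (1 - δ)) ≤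
        n * (D + (2 * δ * Real.log 2 - Real.log (1 - δ) - δ * Real.log δ)) := by
      have := le_mul_of_one_le_left hE hn'
      nlinarith
    exact le_of_mul_le_mul_left k3 (by linarith)
  have hc : ContinuousAt (fun δ : ℝ => D + (2 * δ * Real.log 2 - Real.log (1 - δ) -
      δ * Real.log δ)) 0 := by
    have h1 : ContinuousAt (fun δ : ℝ => Real.log (1 - δ)) 0 :=
      ContinuousAt.log (by fun_prop) (by norm_num)
    have h2 : ContinuousAt (fun δ : ℝ => δ * Real.log δ) 0 := Real.continuous_mul_log.continuousAt
    have h3 : ContinuousAt (fun δ : ℝ => 2 * δ * Real.log 2) 0 := by fun_prop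
    exact continuousAt_const.add ((h3.sub h1).sub h2)
  have hc' : ContinuousAt (fun δ : ℝ => R * Real.log 2 * (1 - δ)) 0 := by fun_prop
  have hlim := le_of_tendsto_of_tendsto (hc'.tendsto.mono_left (nhdsWithin_le_nhds (s := Set.Ioi 0)))
    (hc.tendsto.mono_left nhdsWithin_le_nhds) (by
      filter_upwards [Ioo_mem_nhdsGT (zero_lt_one' ℝ)] with δ hδ' using hδ δ hδ'.1 hδ'.2)
  simpa using hlim

/-! ### The bias of a one-bit quantized Gaussian channel -/

theorem oneBit_true (s : ℝ) (v : ℝ≥0) : oneBit s v true = gaussianReal s v (Set.Ici 0) := by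
  have hm : Measurable fun t : ℝ => decide (0 ≤ t) := measurable_to_bool
    (by simpa [Set.preimage, Set.Ici] using measurableSet_Ici (a := (0 : ℝ)))
  rw [oneBit, Measure.toPMF_apply, Measure.map_apply hm (measurableSet_singleton _)]
  congr 1
  ext t
  simp

theorem oneBit_false (s : ℝ) (v : ℝ≥0) : oneBit s v false = gaussianReal s v (Set.Iio 0) := by
  have hm : Measurable fun t : ℝ => decide (0 ≤ t) := measurable_to_bool
    (by simpa [Set.preimage, Set.Ici] using measurableSet_Ici (a := (0 : ℝ)))
  rw [oneBit, Measure.toPMF_apply, Measure.map_apply hm (measurableSet_singleton _)]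
  congr 1
  ext t
  simp

theorem oneBit_toReal_pos (s : ℝ) {v : ℝ≥0} (hv : v ≠ 0) (b : Bool) :
    0 < (oneBit s v b).toReal := by
  refine ENNReal.toReal_pos (fun h => ?_) (PMF.apply_ne_top _ _)
  cases b with
  | true =>
    rw [oneBit_true] at h
    simpa using gaussianReal_absolutelyContinuous' s hv h
  | false =>
    rw [oneBit_false] at h
    simpa using gaussianReal_absolutelyContinuous' s hv h

theorem oneBit_neg_true (s : ℝ) {v : ℝ≥0} (hv : v ≠ 0) :
    oneBit (-s) v true = oneBit s v false := by
  have := nullSingletonClass_gaussianReal (μ := s) hv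
  rw [oneBit_true, oneBit_false, ← gaussianReal_map_neg,
    Measure.map_apply measurable_neg measurableSet_Ici, ← measure_congr Iio_ae_eq_Iic.symm]
  congr 1
  ext t
  simp

/-- The bias of the quantizer output towards the sign of the input `w`: its output equals the sign
of the input with probability `(1 + signBias w v) / 2`. -/
def signBias (w : ℝ) (v : ℝ≥0) : ℝ := (oneBit w v true).toReal - (oneBit w v false).toReal

theorem oneBit_true_add_false (s : ℝ) (v : ℝ≥0) :
    (oneBit s v true).toReal + (oneBit s v false).toReal = 1 := by
  simpa using sum_toReal_pmf (oneBit s v)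

/-- The sign recorded by a bit, as the number `1` (for `true`) or `-1` (for `false`). -/
def sgn (b : Bool) : ℝ := if b then 1 else -1

theorem toReal_oneBit_bpsk (w : ℝ) {v : ℝ≥0} (hv : v ≠ 0) (r b : Bool) :
    (oneBit (bpsk w r) v b).toReal = (1 + signBias w v * (sgn r * sgn b)) / 2 := by
  have h1 := oneBit_true_add_false w v
  have h2 := oneBit_true_add_false (-w) v
  have h3 := oneBit_neg_true w hv
  rw [h3] at h2
  cases r <;> cases b <;> simp [bpsk, sgn, signBias, h3] <;> linarith

theorem abs_signBias_lt_one (w : ℝ) {v : ℝ≥0} (hv : v ≠ 0) : |signBias w v| < 1 := by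
  have h1 := oneBit_true_add_false w v
  have h2 := oneBit_toReal_pos w hv true
  have h3 := oneBit_toReal_pos w hv false
  rw [signBias, abs_lt]
  constructor <;> linarith

theorem gaussianReal_real_Icc_le (μ : ℝ) {v : ℝ≥0} (hv : v ≠ 0) {a b : ℝ} (hab : a ≤ b) :
    (gaussianReal μ v).real (Set.Icc a b) ≤ (√(2 * Real.pi * v))⁻¹ * (b - a) := by
  refine ENNReal.toReal_le_of_le_ofReal (by have := sub_nonneg.mpr hab; positivity) ?_
  rw [gaussianReal_apply μ hv]
  calc ∫⁻ x in Set.Icc a b, gaussianPDF μ v x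
      ≤ ∫⁻ _ in Set.Icc a b, ENNReal.ofReal (√(2 * Real.pi * v))⁻¹ := by
        refine lintegral_mono fun x => ENNReal.ofReal_le_ofReal ?_
        rw [gaussianPDFReal]
        refine mul_le_of_le_one_right (by positivity) (Real.exp_le_one_iff.mpr ?_)
        rw [neg_div, neg_nonpos]
        positivity
    _ = _ := by
        rw [setLIntegral_const, Real.volume_Icc, ← ENNReal.ofReal_mul (by positivity)]

/-- The bias is the probability that the noise does not exceed the amplitude: larger noise decides
the output regardless of the input, and it is as likely positive as negative. -/
theorem signBias_eq {w : ℝ} (hw : 0 ≤ w) {v : ℝ≥0} (hv : v ≠ 0) :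
    signBias w v = (gaussianReal 0 v).real (Set.Icc (-w) w) := by
  have e1 : oneBit w v true = gaussianReal 0 v (Set.Ici (-w)) := by
    rw [oneBit_true, ← zero_add w, ← gaussianReal_map_add_const,
      Measure.map_apply (by fun_prop) measurableSet_Ici]
    congr 1
    ext t
    simp [neg_le_iff_add_nonneg]
  have e2 : oneBit w v false = gaussianReal 0 v (Set.Ici w) := by
    rw [← oneBit_neg_true w hv, oneBit_true, ← zero_add (-w), ← gaussianReal_map_add_const,
      Measure.map_apply (by fun_prop) measurableSet_Ici]
    congr 1
    ext t
    simp
  have := nullSingletonClass_gaussianReal (μ := 0) hv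
  have e3 : gaussianReal 0 v (Set.Ici w) = gaussianReal 0 v (Set.Ioi w) :=
    (measure_congr Ioi_ae_eq_Ici).symm
  have e4 : (gaussianReal 0 v).real (Set.Ici (-w)) =
      (gaussianReal 0 v).real (Set.Icc (-w) w) + (gaussianReal 0 v).real (Set.Ioi w) := by
    rw [← measureReal_union _ measurableSet_Ioi, Set.Icc_union_Ioi_eq_Ici (by linarith)]
    exact Set.disjoint_left.mpr fun t ht ht' => not_lt.mpr ht.2 ht'
  rw [signBias, e1, e2, e3]
  simp only [Measure.real] at *
  linarith

theorem signBias_nonneg {w : ℝ} (hw : 0 ≤ w) {v : ℝ≥0} (hv : v ≠ 0) : 0 ≤ signBias w v := by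
  rw [signBias_eq hw hv]
  exact measureReal_nonneg

/-- The density of the noise is at most `1 / √(2πQ)`, so that the bias is at most `2w / √(2πQ)`. -/
theorem signBias_sq_le {w Q : ℝ} (hw : 0 ≤ w) (hQ : 0 < Q) :
    signBias w Q.toNNReal ^ 2 ≤ w ^ 2 / Q := by
  have hv : Q.toNNReal ≠ 0 := by simpa using hQ
  have h := gaussianReal_real_Icc_le 0 hv (show -w ≤ w by linarith)
  rw [← signBias_eq hw hv, Real.coe_toNNReal _ hQ.le] at h
  calc signBias w Q.toNNReal ^ 2 ≤ ((√(2 * Real.pi * Q))⁻¹ * (w - -w)) ^ 2 :=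
        pow_le_pow_left₀ (signBias_nonneg hw hv) h 2
    _ = w ^ 2 / Q * (2 / Real.pi) := by
        rw [mul_pow, inv_pow, Real.sq_sqrt (by positivity)]
        field_simp
        ring
    _ ≤ w ^ 2 / Q := mul_le_of_le_one_right (by positivity)
        ((div_le_one Real.pi_pos).mpr Real.two_le_pi)

/-! ### The quantized satellite source -/

/-- All odd moments of the signs vanish, and the pairwise correlations are the products of the
biases. -/
theorem toReal_sourceLaw (w : ℝ) {Q : ℝ} (hQ : 0 < Q) (c : Bool × Bool × Bool) :
    (sourceLaw w Q c).toReal =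
      (1 + signBias w Q.toNNReal ^ 2 * (sgn c.1 * sgn c.2.1)
        + signBias w Q.toNNReal * signBias w 1 * (sgn c.1 * sgn c.2.2)
        + signBias w Q.toNNReal * signBias w 1 * (sgn c.2.1 * sgn c.2.2)) / 8 := by
  classical
  have hv : Q.toNNReal ≠ 0 := by simpa using hQ
  obtain ⟨x, y, z⟩ := c
  have h : sourceLaw w Q (x, y, z) = ∑ r, 2⁻¹ * (oneBit (bpsk w r) Q.toNNReal x *
      (oneBit (bpsk w r) Q.toNNReal y * oneBit (bpsk w r) 1 z)) := by
    rw [sourceLaw, PMF.bind_apply, tsum_fintype]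
    refine Finset.sum_congr rfl fun r _ => ?_
    rw [PMF.uniformOfFintype_apply, Fintype.card_bool, Nat.cast_ofNat]
    congr 1
    simp only [PMF.bind_apply, PMF.map_apply]
    rw [tsum_eq_single x fun x' hx' => by simp [hx'.symm],
      tsum_eq_single y fun y' hy' => by simp [hy'.symm],
      tsum_eq_single z fun z' hz' => by simp [hz'.symm]]
    simp
  rw [h, ENNReal.toReal_sum fun r _ => by
    refine ENNReal.mul_ne_top (by simp) (ENNReal.mul_ne_top (PMF.apply_ne_top _ _)
      (ENNReal.mul_ne_top (PMF.apply_ne_top _ _) (PMF.apply_ne_top _ _)))]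
  simp only [ENNReal.toReal_mul, toReal_oneBit_bpsk w hv, toReal_oneBit_bpsk w one_ne_zero,
    Fintype.sum_bool, ENNReal.toReal_inv, ENNReal.toReal_ofNat]
  cases x <;> cases y <;> cases z <;> simp [sgn] <;> ring

theorem toReal_sourceLaw_pos (w : ℝ) {Q : ℝ} (hQ : 0 < Q) (c : Bool × Bool × Bool) :
    0 < (sourceLaw w Q c).toReal := by
  have hv : Q.toNNReal ≠ 0 := by simpa using hQ
  have ha := abs_signBias_lt_one w hv
  have h1 := abs_lt.mp ha
  have h2 := abs_lt.mp (abs_signBias_lt_one w one_ne_zero)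
  rw [toReal_sourceLaw w hQ]
  generalize signBias w Q.toNNReal = a at *
  generalize signBias w 1 = b at *
  obtain ⟨x, y, z⟩ := c
  -- Each of the eight probabilities is a sum of two of these products, one for each satellite bit.
  have k1 := mul_pos (mul_pos (sub_pos.mpr h1.2) (sub_pos.mpr h1.2)) (sub_pos.mpr h2.2)
  have k2 := mul_pos (mul_pos (sub_pos.mpr h1.2) (sub_pos.mpr h1.2)) (sub_pos.mpr h2.1)
  have k3 := mul_pos (mul_pos (sub_pos.mpr h1.2) (sub_pos.mpr h1.1)) (sub_pos.mpr h2.2)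
  have k4 := mul_pos (mul_pos (sub_pos.mpr h1.2) (sub_pos.mpr h1.1)) (sub_pos.mpr h2.1)
  have k5 := mul_pos (mul_pos (sub_pos.mpr h1.1) (sub_pos.mpr h1.1)) (sub_pos.mpr h2.2)
  have k6 := mul_pos (mul_pos (sub_pos.mpr h1.1) (sub_pos.mpr h1.1)) (sub_pos.mpr h2.1)
  cases x <;> cases y <;> cases z <;> simp [sgn] <;> first | exact ha | nlinarith

theorem one_add_mul_sgn_pos {a b : ℝ} (ha : |a| < 1) (hb : |b| < 1) (x y : Bool) :
    0 < 1 + a * b * (sgn x * sgn y) := by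
  have hab : |a * b| < 1 := by
    rw [abs_mul]
    nlinarith [abs_nonneg a, abs_nonneg b]
  have hm := abs_lt.mp hab
  cases x <;> cases y <;> simp [sgn] <;> linarith

/-- The conditional mutual information `I(X;Y|Z)` of one quantized sample is at most `a ^ 4` nats,
where `a` is the bias of Alice's and Bob's bits and `b` that of Eve's. The denominator is
`p(x,z) p(y|z)`. The divergence is at most the `χ²`-divergence, and given `Z` the bits `X` and `Y`
have covariance `a² (1 - b²)` and variances `1 - a² b² ≥ 1 - b²`. -/
theorem sum_mul_log_sourceLaw_le {a b : ℝ} (ha : |a| < 1) (hb : |b| < 1)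
    (p : Bool × Bool × Bool → ℝ) (hp : ∀ c, 0 < p c)
    (hpe : ∀ c, p c = (1 + a ^ 2 * (sgn c.1 * sgn c.2.1) + a * b * (sgn c.1 * sgn c.2.2)
        + a * b * (sgn c.2.1 * sgn c.2.2)) / 8) :
    ∑ c : Bool × Bool × Bool, p c * Real.log (p c /
      ((1 + a * b * (sgn c.1 * sgn c.2.2)) / 4 * ((1 + a * b * (sgn c.2.1 * sgn c.2.2)) / 2))) ≤
      a ^ 4 := by
  have hq := one_add_mul_sgn_pos ha hb
  have hstep : ∀ c : Bool × Bool × Bool, p c * Real.log (p c /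
      ((1 + a * b * (sgn c.1 * sgn c.2.2)) / 4 * ((1 + a * b * (sgn c.2.1 * sgn c.2.2)) / 2))) ≤
      p c * (p c / ((1 + a * b * (sgn c.1 * sgn c.2.2)) / 4 *
        ((1 + a * b * (sgn c.2.1 * sgn c.2.2)) / 2)) - 1) := fun c =>
    mul_le_mul_of_nonneg_left (Real.log_le_sub_one_of_pos (div_pos (hp c)
      (mul_pos (div_pos (hq _ _) (by norm_num)) (div_pos (hq _ _) (by norm_num))))) (hp c).le
  refine (Finset.sum_le_sum fun c _ => hstep c).trans ?_
  have d1 : 0 < 1 + a * b := by simpa [sgn] using hq true true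
  have d2 : 0 < 1 - a * b := by simpa [sgn, sub_eq_add_neg] using hq true false
  -- The left side is `∑ p² / q - 1`, the `χ²`-divergence.
  have heq : ∑ c : Bool × Bool × Bool, p c * (p c / ((1 + a * b * (sgn c.1 * sgn c.2.2)) / 4 *
        ((1 + a * b * (sgn c.2.1 * sgn c.2.2)) / 2)) - 1) =
      a ^ 4 * ((1 - b ^ 2) / ((1 + a * b) * (1 - a * b))) ^ 2 := by
    simp only [hpe, Fintype.sum_prod_type, Fintype.sum_bool, sgn]
    simp only [if_true, mul_one, mul_neg, neg_neg, Bool.false_eq_true, if_false, ← sub_eq_add_neg]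
    have d1' := d1.ne'
    have d2' := d2.ne'
    field_simp
    ring
  rw [heq]
  have hb2 : b ^ 2 ≤ 1 := by rw [sq_le_one_iff_abs_le_one]; exact hb.le
  have ha2 : a ^ 2 ≤ 1 := by rw [sq_le_one_iff_abs_le_one]; exact ha.le
  refine mul_le_of_le_one_right (by positivity) (pow_le_one₀ ?_ ?_)
  · exact div_nonneg (by linarith) (by positivity)
  · rw [div_le_one (by positivity)]
    nlinarith [mul_le_mul_of_nonneg_right ha2 (sq_nonneg b)]

/-- The explicit bound `S^q(w, Q) ≤ (w² / Q)² / ln 2`, valid for all positive `w` and `Q`. -/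
theorem capacity_le {w Q : ℝ} (hw : 0 < w) (hQ : 0 < Q) :
    capacity w Q ≤ ENNReal.ofReal (w ^ 4 / Real.log 2 * (1 / Q ^ 2)) := by
  have hl2 : 0 < Real.log 2 := Real.log_pos one_lt_two
  refine iSup₂_le fun R hR => ENNReal.ofReal_le_ofReal ?_
  have hv : Q.toNNReal ≠ 0 := by simpa using hQ
  have h1 := abs_signBias_lt_one w hv
  have h2 := abs_signBias_lt_one w one_ne_zero
  have hq := one_add_mul_sgn_pos h1 h2
  have h3 := hR.mul_log_two_le
    (fun x z => (1 + signBias w Q.toNNReal * signBias w 1 * (sgn x * sgn z)) / 4)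
    (fun y z => (1 + signBias w Q.toNNReal * signBias w 1 * (sgn y * sgn z)) / 2)
    (toReal_sourceLaw_pos w hQ) (fun x z => div_pos (hq x z) (by norm_num))
    (fun y z => div_pos (hq y z) (by norm_num))
    (by
      simp only [Fintype.sum_prod_type, Fintype.sum_bool, sgn]
      simp
      ring)
  have h4 := h3.trans (sum_mul_log_sourceLaw_le h1 h2 _ (toReal_sourceLaw_pos w hQ)
    (toReal_sourceLaw w hQ))
  have h5 := pow_le_pow_left₀ (sq_nonneg _) (signBias_sq_le hw.le hQ) 2
  rw [div_mul_eq_mul_div, le_div_iff₀ hl2]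
  calc R * Real.log 2 ≤ (signBias w Q.toNNReal ^ 2) ^ 2 := by rw [← pow_mul]; exact h4
    _ ≤ (w ^ 2 / Q) ^ 2 := h5
    _ = _ := by ring

end

end SatelliteSK

theorem theorem1 (W : Set ℝ) (hW : W.Nonempty) (hpos : ∀ w ∈ W, 0 < w)
    (hbdd : Bornology.IsBounded W) :
    (∀ Q : ℝ, 1 < Q → SatelliteSK.capacityOn W Q ≠ ∞) ∧
    (fun Q : ℝ => (SatelliteSK.capacityOn W Q).toReal) =O[atTop] fun Q : ℝ => 1 / Q ^ 2 := by
  obtain ⟨M, hM⟩ := hbdd.exists_norm_le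
  have hle : ∀ Q : ℝ, 1 < Q →
      SatelliteSK.capacityOn W Q ≤ ENNReal.ofReal (M ^ 4 / Real.log 2 * (1 / Q ^ 2)) := by
    intro Q hQ
    refine iSup₂_le fun w hw => (SatelliteSK.capacity_le (hpos w hw) (by linarith)).trans ?_
    have hl2 : 0 < Real.log 2 := Real.log_pos one_lt_two
    have hw0 := (hpos w hw).le
    have hwM : w ≤ M := (le_abs_self w).trans (hM w hw)
    gcongr
  refine ⟨fun Q hQ => ne_top_of_le_ne_top ENNReal.ofReal_ne_top (hle Q hQ), ?_⟩
  refine IsBigO.of_bound (M ^ 4 / Real.log 2) ?_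
  filter_upwards [eventually_gt_atTop 1] with Q hQ
  have hl2 : 0 < Real.log 2 := Real.log_pos one_lt_two
  rw [Real.norm_of_nonneg ENNReal.toReal_nonneg, Real.norm_of_nonneg (by positivity)]
  exact ENNReal.toReal_le_of_le_ofReal (by positivity) (hle Q hQ)
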